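/- Let $X,Y,Z$ be the Pauli matrices, and for real $\theta_x,\theta_y\ge 0$ and $\theta_z\in\mathbb{R}$ let $$D_b=e^{i(\theta_x X\otimes X+\theta_y Y\otimes Y)},\qquad D_c=e^{i(\theta_x X\otimes X+\theta_y Y\otimes Y+\theta_z Z\otimes Z)}.$$ Let $U\in SU(4)$ be a two-qubit gate with Cartan coordinate $(\eta_x,\eta_y,\eta_z)$, i.e. $U=k_g\,(a\otimes b)\,e^{i(\eta_x X\otimes X+\eta_y Y\otimes Y+\eta_z Z\otimes Z)}\,(c\otimes d)$ for some $k_g\in\{1,i\}$ and $a,b,c,d\in SU(2)$, where $0\le|\eta_z|\le\eta_y\le\eta_x\le\frac{\pi}{4}$, and $\eta_z\ge 0$ if $\eta_x=\frac{\pi}{4}$. Let $k_t(U)=|\eta_x|+|\eta_y|+|\eta_z|$ be the $L^1$ norm of this coordinate. The decomposition cost of $U$ with a two-qubit gate $g$ is the least number of occurrences of $g$ in a two-qubit circuit that is composed of $g$ and arbitrary single-qubit unitary gates and whose product is $U$. 1. If $U$ has decomposition cost $N$ with $D_b$ and $N(\theta_x+\theta_y)<\frac{\pi}{4}$, then $\sin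 k_t(U)\le\sin\big(N(\theta_x+\theta_y)\big)$. 2. If $U$ has decomposition cost $N$ with $D_c$ and $N(\theta_x+\theta_y+|\theta_z|)<\frac{\pi}{4}$, then $\sin k_t(U)\le\sin\big(N(\theta_x+\theta_y+|\theta_z|)\big)$. -/

import Mathlib

open scoped Kronecker

noncomputable section

/-- Operators on the two qubits `q₀, q₁`, in the computational basis `Fin 2 × Fin 2`. -/
abbrev TwoQubitOp : Type := Matrix (Fin 2 × Fin 2) (Fin 2 × Fin 2) ℂ

/-- The Pauli matrix `X`. -/
def pauliX : Matrix (Fin 2) (Fin 2) ℂ := !![0, 1; 1, 0]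

/-- The Pauli matrix `Y`. -/
def pauliY : Matrix (Fin 2) (Fin 2) ℂ := !![0, -Complex.I; Complex.I, 0]

/-- The Pauli matrix `Z`. -/
def pauliZ : Matrix (Fin 2) (Fin 2) ℂ := !![1, 0; 0, -1]

/-- The gate `D_b(θx, θy) = exp (i (θx X₀X₁ + θy Y₀Y₁))`. -/
def gateDb (θx θy : ℝ) : TwoQubitOp :=
  NormedSpace.exp (Complex.I •
    ((θx : ℂ) • (pauliX ⊗ₖ pauliX) + (θy : ℂ) • (pauliY ⊗ₖ pauliY)))

/-- The gate `D_c(θx, θy, θz) = exp (i (θx X₀X₁ + θy Y₀Y₁ + θz Z₀Z₁))`. -/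
def gateDc (θx θy θz : ℝ) : TwoQubitOp :=
  NormedSpace.exp (Complex.I •
    ((θx : ℂ) • (pauliX ⊗ₖ pauliX) + (θy : ℂ) • (pauliY ⊗ₖ pauliY)
      + (θz : ℂ) • (pauliZ ⊗ₖ pauliZ)))

/-- `(ηx, ηy, ηz)` is the Cartan coordinate of `U`: there is a KAK decomposition
`U = k_g (a ⊗ b) exp (i (ηx X₀X₁ + ηy Y₀Y₁ + ηz Z₀Z₁)) (c ⊗ d)` with `k_g ∈ {1, i}`,
`a, b, c, d ∈ SU(2)`, `0 ≤ |ηz| ≤ ηy ≤ ηx ≤ π/4`, and `ηz ≥ 0` when `ηx = π/4`. -/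
def IsCartanCoordinate (U : TwoQubitOp) (ηx ηy ηz : ℝ) : Prop :=
  |ηz| ≤ ηy ∧ ηy ≤ ηx ∧ ηx ≤ Real.pi / 4 ∧ (ηx = Real.pi / 4 → 0 ≤ ηz) ∧
    ∃ (kg : ℂ) (a b c d : Matrix.specialUnitaryGroup (Fin 2) ℂ),
      (kg = 1 ∨ kg = Complex.I) ∧
      U = kg • ((a.1 ⊗ₖ b.1) * gateDc ηx ηy ηz * (c.1 ⊗ₖ d.1))

/-- The instructions of a circuit on two qubits: any single-qubit gate on `q₀`, any single-qubit
gate on `q₁`, or one invocation of the two-qubit basis gate. -/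
inductive Instr : Type
  | onQ0 (a : Matrix.unitaryGroup (Fin 2) ℂ) : Instr
  | onQ1 (b : Matrix.unitaryGroup (Fin 2) ℂ) : Instr
  | basis : Instr

/-- The operator of one instruction when the basis gate is `g`. -/
def Instr.op (g : TwoQubitOp) : Instr → TwoQubitOp
  | .onQ0 a => a.1 ⊗ₖ (1 : Matrix (Fin 2) (Fin 2) ℂ)
  | .onQ1 b => (1 : Matrix (Fin 2) (Fin 2) ℂ) ⊗ₖ b.1
  | .basis => g

/-- The number of invocations of the basis gate in one instruction. -/
def Instr.cost : Instr → ℕ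
  | .onQ0 _ => 0
  | .onQ1 _ => 0
  | .basis => 1

/-- The operator of a circuit, written as an operator product. -/
def circuitOp (g : TwoQubitOp) (C : List Instr) : TwoQubitOp :=
  (C.map (Instr.op g)).prod

/-- The number of invocations of the basis gate in a circuit. -/
def circuitCost (C : List Instr) : ℕ :=
  (C.map Instr.cost).sum

/-- `N` is the decomposition cost of `U` with the basis gate `g`: the least number of invocations
of `g` in a circuit that synthesizes `U`. -/
def IsDecompositionCost (g U : TwoQubitOp) (N : ℕ) : Prop :=
  IsLeast {n : ℕ | ∃ C : List Instr, circuitOp g C = U ∧ circuitCost C = n} N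

end

open Matrix InnerProductGeometry

/-! The Bell basis diagonalizes every Cartan gate, with phases bounded by the `L¹` norm of its
parameters, so such a gate turns each state by at most that real angle (`angle_gateDc_mulVec_le`).
Angles are unitarily invariant and satisfy the triangle inequality, so a circuit stays within `r` =
cost times `L¹` norm of the local gate left after deleting its basis gates
(`exists_local_gate_angle_le`). Moving the local factors of the KAK decomposition across, the Cartan
part of `U` is within `r` of a local gate, up to `k_g`. The diagonal Bell entries of a local gate
are real up to a common phase, which the determinant condition makes a power of `i`. So all phases
lie near `πℤ`, or all near `π/2 + πℤ` (`cos_le_abs_cos_or_cos_le_abs_sin`). The bounds on the Cartan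
coordinate exclude the second case, and in the first the phase of modulus `k_t(U)` gives `k_t(U) ≤
r`. -/

/-! ### Cartan gates in the Bell basis -/

/-- The unnormalized Bell vectors, as the columns of a matrix. -/
def bellMatrix : TwoQubitOp :=
  fun p c => if p.1 + p.2 = c.1 then (if p.1 = 1 ∧ c.2 = 1 then -1 else 1) else 0

/-- The eigenvalue of `ηx X₀X₁ + ηy Y₀Y₁ + ηz Z₀Z₁` at the Bell vector with index `c`. -/
def bellPhase (ηx ηy ηz : ℝ) (c : Fin 2 × Fin 2) : ℝ :=
  (-1) ^ (c.2 : ℕ) * ηx - (-1) ^ (c.1 : ℕ) * (-1) ^ (c.2 : ℕ) * ηy + (-1) ^ (c.1 : ℕ) * ηz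

theorem gateDb_eq_gateDc (θx θy : ℝ) : gateDb θx θy = gateDc θx θy 0 := by
  simp [gateDb, gateDc]

theorem conjTranspose_bellMatrix_mul_self : bellMatrixᴴ * bellMatrix = (2 : ℂ) • 1 := by
  ext ⟨i, j⟩ ⟨k, l⟩
  fin_cases i <;> fin_cases j <;> fin_cases k <;> fin_cases l <;>
    simp [bellMatrix, Matrix.mul_apply, Fintype.sum_prod_type] <;> norm_num

theorem isUnit_bellMatrix : IsUnit bellMatrix := by
  refine IsUnit.of_mul_eq_one_right ((2⁻¹ : ℂ) • bellMatrixᴴ) ?_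
  rw [Matrix.smul_mul, conjTranspose_bellMatrix_mul_self, smul_smul]
  norm_num

theorem pauli_generator_mul_bellMatrix (ηx ηy ηz : ℝ) :
    ((ηx : ℂ) • (pauliX ⊗ₖ pauliX) + (ηy : ℂ) • (pauliY ⊗ₖ pauliY)
      + (ηz : ℂ) • (pauliZ ⊗ₖ pauliZ)) * bellMatrix =
      bellMatrix * diagonal fun c => (bellPhase ηx ηy ηz c : ℂ) := by
  ext ⟨i, j⟩ ⟨k, l⟩
  rw [Matrix.mul_diagonal]
  fin_cases i <;> fin_cases j <;> fin_cases k <;> fin_cases l <;>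
    simp [bellMatrix, bellPhase, pauliX, pauliY, pauliZ, Matrix.mul_apply, Fintype.sum_prod_type,
      Matrix.add_apply, Matrix.smul_apply] <;> ring

theorem gateDc_eq_conj_diagonal (ηx ηy ηz : ℝ) :
    gateDc ηx ηy ηz = bellMatrix *
      diagonal (fun c => Complex.exp (bellPhase ηx ηy ηz c * Complex.I)) * bellMatrix⁻¹ := by
  have hdet := (Matrix.isUnit_iff_isUnit_det _).1 isUnit_bellMatrix
  have hgen : Complex.I • ((ηx : ℂ) • (pauliX ⊗ₖ pauliX) + (ηy : ℂ) • (pauliY ⊗ₖ pauliY)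
      + (ηz : ℂ) • (pauliZ ⊗ₖ pauliZ)) =
      bellMatrix * diagonal (fun c => (bellPhase ηx ηy ηz c : ℂ) * Complex.I) * bellMatrix⁻¹ := by
    have hd : diagonal (fun c => (bellPhase ηx ηy ηz c : ℂ) * Complex.I) =
        Complex.I • diagonal (fun c => (bellPhase ηx ηy ηz c : ℂ)) := by
      rw [← diagonal_smul]
      congr 1
      ext c
      simp [mul_comm]
    rw [hd, Matrix.mul_smul, Matrix.smul_mul, ← pauli_generator_mul_bellMatrix,
      Matrix.mul_nonsing_inv_cancel_right _ _ hdet]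
  rw [gateDc, hgen, Matrix.exp_conj _ _ isUnit_bellMatrix, Matrix.exp_diagonal]
  congr 3
  ext c
  rw [Pi.exp_def, ← Complex.exp_eq_exp_ℂ]

theorem gateDc_mulVec_bellMatrix_mulVec (ηx ηy ηz : ℝ) (z : Fin 2 × Fin 2 → ℂ) :
    gateDc ηx ηy ηz *ᵥ (bellMatrix *ᵥ z) =
      bellMatrix *ᵥ fun c => Complex.exp (bellPhase ηx ηy ηz c * Complex.I) * z c := by
  have hdet := (Matrix.isUnit_iff_isUnit_det _).1 isUnit_bellMatrix
  rw [gateDc_eq_conj_diagonal, mulVec_mulVec, Matrix.nonsing_inv_mul_cancel_right _ _ hdet,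
    ← mulVec_mulVec]
  congr 1
  ext c
  rw [mulVec_diagonal]

/-- The four Bell phases sum to zero. Hence only local gates contribute to the determinant of a
circuit. -/
theorem det_gateDc (ηx ηy ηz : ℝ) : (gateDc ηx ηy ηz).det = 1 := by
  rw [gateDc_eq_conj_diagonal, Matrix.det_conj isUnit_bellMatrix, det_diagonal, ← Complex.exp_sum,
    Complex.exp_eq_one_iff]
  refine ⟨0, ?_⟩
  simp [Fintype.sum_prod_type, bellPhase]
  ring

theorem abs_bellPhase_le (ηx ηy ηz : ℝ) (c : Fin 2 × Fin 2) :
    |bellPhase ηx ηy ηz c| ≤ |ηx| + |ηy| + |ηz| := by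
  obtain ⟨i, j⟩ := c
  have := le_abs_self ηx
  have := neg_abs_le ηx
  have := le_abs_self ηy
  have := neg_abs_le ηy
  have := le_abs_self ηz
  have := neg_abs_le ηz
  rw [abs_le]
  fin_cases i <;> fin_cases j <;> simp [bellPhase] <;> constructor <;> linarith

/-! ### Real angles between states, and circuits -/

/-- The real inner product of two state vectors. -/
theorem real_inner_toLp {ι : Type*} [Fintype ι] (v w : ι → ℂ) :
    inner ℝ (WithLp.toLp 2 v) (WithLp.toLp 2 w) = (star v ⬝ᵥ w).re := by
  simp [PiLp.inner_apply, dotProduct, Complex.inner, Complex.re_sum, mul_comm]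

theorem star_mulVec_dotProduct_mulVec {ι : Type*} [Fintype ι] (M : Matrix ι ι ℂ) (v w : ι → ℂ) :
    star (M *ᵥ v) ⬝ᵥ (M *ᵥ w) = star v ⬝ᵥ ((Mᴴ * M) *ᵥ w) := by
  rw [star_mulVec, ← dotProduct_mulVec, mulVec_mulVec]

theorem angle_unitary_mulVec {ι : Type*} [Fintype ι] [DecidableEq ι] {M : Matrix ι ι ℂ}
    (hM : M ∈ unitaryGroup ι ℂ) (v w : ι → ℂ) :
    angle (WithLp.toLp 2 (M *ᵥ v)) (WithLp.toLp 2 (M *ᵥ w)) =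
      angle (WithLp.toLp 2 v) (WithLp.toLp 2 w) := by
  have h : Mᴴ * M = 1 := mem_unitaryGroup_iff'.1 hM
  have hinner (a b : ι → ℂ) : inner ℝ (WithLp.toLp 2 (M *ᵥ a)) (WithLp.toLp 2 (M *ᵥ b)) =
      inner ℝ (WithLp.toLp 2 a) (WithLp.toLp 2 b) := by
    rw [real_inner_toLp, real_inner_toLp, star_mulVec_dotProduct_mulVec, h, one_mulVec]
  have hnorm (a : ι → ℂ) : ‖WithLp.toLp 2 (M *ᵥ a)‖ = ‖WithLp.toLp 2 a‖ := by
    rw [norm_eq_sqrt_real_inner, norm_eq_sqrt_real_inner, hinner]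
  rw [angle, angle, hinner, hnorm, hnorm]

theorem real_inner_bellMatrix_mulVec (v w : Fin 2 × Fin 2 → ℂ) :
    inner ℝ (WithLp.toLp 2 (bellMatrix *ᵥ v)) (WithLp.toLp 2 (bellMatrix *ᵥ w)) =
      2 * ∑ c, (star (v c) * w c).re := by
  rw [real_inner_toLp, star_mulVec_dotProduct_mulVec, conjTranspose_bellMatrix_mul_self,
    smul_mulVec, one_mulVec, dotProduct_smul]
  simp [dotProduct]

/-- A Cartan gate turns every state by an angle of at most the `L¹` norm of its parameters. -/
theorem angle_gateDc_mulVec_le (θx θy θz : ℝ) {v : Fin 2 × Fin 2 → ℂ} (hv : v ≠ 0) :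
    angle (WithLp.toLp 2 (gateDc θx θy θz *ᵥ v)) (WithLp.toLp 2 v) ≤ |θx| + |θy| + |θz| := by
  set S := |θx| + |θy| + |θz| with hS
  rcases le_total Real.pi S with hpi | hpi
  · exact (angle_le_pi _ _).trans hpi
  have hdet := (Matrix.isUnit_iff_isUnit_det _).1 isUnit_bellMatrix
  obtain ⟨z, rfl⟩ : ∃ z, v = bellMatrix *ᵥ z :=
    ⟨bellMatrix⁻¹ *ᵥ v, by rw [mulVec_mulVec, Matrix.mul_nonsing_inv _ hdet, one_mulVec]⟩
  have hnorm : ‖WithLp.toLp 2 (gateDc θx θy θz *ᵥ (bellMatrix *ᵥ z))‖ =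
      ‖WithLp.toLp 2 (bellMatrix *ᵥ z)‖ := by
    rw [gateDc_mulVec_bellMatrix_mulVec, norm_eq_sqrt_real_inner, norm_eq_sqrt_real_inner,
      real_inner_bellMatrix_mulVec, real_inner_bellMatrix_mulVec]
    congr 3
    ext c
    rw [star_mul', mul_mul_mul_comm, Complex.star_def, ← Complex.exp_conj, ← Complex.exp_add]
    simp
  have hpos : 0 < ‖WithLp.toLp 2 (bellMatrix *ᵥ z)‖ := by
    rw [norm_pos_iff]
    simpa using hv
  have hinner : Real.cos S * ‖WithLp.toLp 2 (bellMatrix *ᵥ z)‖ ^ 2 ≤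
      inner ℝ (WithLp.toLp 2 (gateDc θx θy θz *ᵥ (bellMatrix *ᵥ z)))
        (WithLp.toLp 2 (bellMatrix *ᵥ z)) := by
    rw [← real_inner_self_eq_norm_sq, gateDc_mulVec_bellMatrix_mulVec,
      real_inner_bellMatrix_mulVec, real_inner_bellMatrix_mulVec, mul_left_comm, Finset.mul_sum]
    gcongr with c
    have hcos : Real.cos S ≤ Real.cos (bellPhase θx θy θz c) := by
      rw [← Real.cos_abs (bellPhase θx θy θz c)]
      exact Real.cos_le_cos_of_nonneg_of_le_pi (abs_nonneg _) hpi (abs_bellPhase_le _ _ _ _)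
    have heq : (star (Complex.exp (bellPhase θx θy θz c * Complex.I) * z c) * z c).re =
        Real.cos (bellPhase θx θy θz c) * (star (z c) * z c).re := by
      simp only [Complex.star_def, Complex.mul_re, Complex.mul_im, Complex.conj_re,
        Complex.conj_im, Complex.exp_ofReal_mul_I_re, Complex.exp_ofReal_mul_I_im]
      ring
    rw [heq]
    gcongr
    simp only [Complex.star_def, Complex.mul_re, Complex.conj_re, Complex.conj_im]
    nlinarith [sq_nonneg (z c).re, sq_nonneg (z c).im]
  rw [angle, hnorm, ← Real.arccos_cos (by positivity : 0 ≤ S) hpi]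
  apply Real.arccos_le_arccos
  rwa [le_div_iff₀ (by positivity), ← sq]

/-- A circuit stays, up to an angle linear in its cost, close to the local gate obtained by
deleting all invocations of the basis gate. -/
theorem exists_local_gate_angle_le (θx θy θz : ℝ) (C : List Instr) :
    ∃ a ∈ unitaryGroup (Fin 2) ℂ, ∃ b ∈ unitaryGroup (Fin 2) ℂ,
      (circuitOp (gateDc θx θy θz) C).det = (a.det * b.det) ^ 2 ∧
      ∀ v : Fin 2 × Fin 2 → ℂ, v ≠ 0 →
        angle (WithLp.toLp 2 (circuitOp (gateDc θx θy θz) C *ᵥ v))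
          (WithLp.toLp 2 ((a ⊗ₖ b) *ᵥ v)) ≤ circuitCost C * (|θx| + |θy| + |θz|) := by
  induction C with
  | nil =>
    refine ⟨1, one_mem _, 1, one_mem _, by simp [circuitOp], fun v hv => ?_⟩
    -- The angle of the zero vector with itself is `π / 2` by convention.
    have hv' : WithLp.toLp 2 v ≠ 0 := by simpa using hv
    simp [circuitOp, circuitCost, angle_self hv']
  | cons s C ih =>
    obtain ⟨a, ha, b, hb, hdet, hang⟩ := ih
    have hop : circuitOp (gateDc θx θy θz) (s :: C) =
        s.op (gateDc θx θy θz) * circuitOp (gateDc θx θy θz) C := by simp [circuitOp]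
    have hcost : circuitCost (s :: C) = s.cost + circuitCost C := by simp [circuitCost]
    rw [hop, hcost]
    cases s with
    | onQ0 u =>
      refine ⟨u.1 * a, mul_mem u.2 ha, b, hb, ?_, fun v hv => ?_⟩
      · rw [det_mul, hdet, det_mul, Instr.op, det_kronecker]
        simp
        ring
      · have hk : (u.1 * a) ⊗ₖ b = (u.1 ⊗ₖ (1 : Matrix (Fin 2) (Fin 2) ℂ)) * (a ⊗ₖ b) := by
          rw [← mul_kronecker_mul, one_mul]
        rw [hk, Instr.op, ← mulVec_mulVec, ← mulVec_mulVec,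
          angle_unitary_mulVec (kronecker_mem_unitary u.2 (one_mem _))]
        simpa [Instr.cost] using hang v hv
    | onQ1 u =>
      refine ⟨a, ha, u.1 * b, mul_mem u.2 hb, ?_, fun v hv => ?_⟩
      · rw [det_mul, hdet, det_mul, Instr.op, det_kronecker]
        simp
        ring
      · have hk : a ⊗ₖ (u.1 * b) = ((1 : Matrix (Fin 2) (Fin 2) ℂ) ⊗ₖ u.1) * (a ⊗ₖ b) := by
          rw [← mul_kronecker_mul, one_mul]
        rw [hk, Instr.op, ← mulVec_mulVec, ← mulVec_mulVec,
          angle_unitary_mulVec (kronecker_mem_unitary (one_mem _) u.2)]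
        simpa [Instr.cost] using hang v hv
    | basis =>
      refine ⟨a, ha, b, hb, ?_, fun v hv => ?_⟩
      · rw [det_mul, hdet, Instr.op, det_gateDc, one_mul]
      · have hne : circuitOp (gateDc θx θy θz) C *ᵥ v ≠ 0 := by
          refine fun h => hv (eq_zero_of_mulVec_eq_zero ?_ h)
          have ha0 : a.det ≠ 0 := (UnitaryGroup.det_isUnit ⟨a, ha⟩).ne_zero
          have hb0 : b.det ≠ 0 := (UnitaryGroup.det_isUnit ⟨b, hb⟩).ne_zero
          rw [hdet]
          positivity
        rw [Instr.op, ← mulVec_mulVec]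
        refine (angle_le_angle_add_angle _
          (WithLp.toLp 2 (circuitOp (gateDc θx θy θz) C *ᵥ v)) _).trans ?_
        refine (add_le_add (angle_gateDc_mulVec_le θx θy θz hne) (hang v hv)).trans ?_
        simp only [Instr.cost]
        push_cast
        linarith

/-! ### Local gates in the Bell basis -/

/-- The entries of a `2 × 2` unitary matrix satisfy `a₁₁ = det a * conj a₀₀` and
`a₁₀ = - det a * conj a₀₁`. -/
theorem unitary_fin_two_entries {a : Matrix (Fin 2) (Fin 2) ℂ} (ha : a ∈ unitaryGroup (Fin 2) ℂ) :
    a 1 1 = a.det * star (a 0 0) ∧ a 1 0 = -(a.det * star (a 0 1)) := by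
  have h : a * aᴴ = 1 := mem_unitaryGroup_iff.1 ha
  have h00 := congrFun (congrFun h 0) 0
  have h10 := congrFun (congrFun h 1) 0
  simp [Matrix.mul_apply, Fin.sum_univ_two] at h00 h10
  rw [det_fin_two]
  simp only [Complex.star_def]
  constructor
  · linear_combination (-a 1 1) * h00 + a 0 1 * h10
  · linear_combination (-a 1 0) * h00 + a 0 0 * h10

/-- The matrix of a local gate in the Bell basis has, up to a phase, real diagonal entries. -/
theorem exists_star_bell_dotProduct_kronecker_mulVec {a b : Matrix (Fin 2) (Fin 2) ℂ}
    (ha : a ∈ unitaryGroup (Fin 2) ℂ) (hb : b ∈ unitaryGroup (Fin 2) ℂ) (c : Fin 2 × Fin 2) :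
    ∃ w : ℂ, star (bellMatrix.col c) ⬝ᵥ ((a ⊗ₖ b) *ᵥ bellMatrix.col c) =
      w + a.det * b.det * star w := by
  obtain ⟨ha1, ha2⟩ := unitary_fin_two_entries ha
  obtain ⟨hb1, hb2⟩ := unitary_fin_two_entries hb
  have hbdet : b.det * star b.det = 1 := Unitary.mul_star_self_of_mem (det_of_mem_unitary hb)
  set da := a.det
  set db := b.det
  simp only [Complex.star_def] at ha1 ha2 hb1 hb2 hbdet ⊢
  obtain ⟨i, j⟩ := c
  fin_cases i
  · refine ⟨a 0 0 * b 0 0 + (-1) ^ (j : ℕ) * (a 0 1 * b 0 1), ?_⟩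
    fin_cases j <;>
      simp [bellMatrix, dotProduct, mulVec, Fintype.sum_prod_type, ha1, ha2, hb1, hb2] <;> ring
  -- These Bell vectors pair `a 0 0` with `b 1 1 = db * star (b 0 0)`; in the conjugate term `db`
  -- cancels by `hbdet`.
  · refine ⟨db * (a 0 0 * star (b 0 0) - (-1) ^ (j : ℕ) * (a 0 1 * star (b 0 1))), ?_⟩
    fin_cases j <;>
      simp [bellMatrix, dotProduct, mulVec, Fintype.sum_prod_type, ha1, ha2, hb1, hb2]
    · linear_combination (-da * (starRingEnd ℂ (a 0 0) * b 0 0 - starRingEnd ℂ (a 0 1) * b 0 1)) *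
        hbdet
    · linear_combination (-da * (starRingEnd ℂ (a 0 0) * b 0 0 + starRingEnd ℂ (a 0 1) * b 0 1)) *
        hbdet

theorem norm_toLp_bellMatrix_col_sq (c : Fin 2 × Fin 2) :
    ‖WithLp.toLp 2 (bellMatrix.col c)‖ ^ 2 = 2 := by
  have h := congrFun (congrFun conjTranspose_bellMatrix_mul_self c) c
  rw [← real_inner_self_eq_norm_sq, real_inner_toLp]
  simp only [Matrix.smul_apply, one_apply_eq, smul_eq_mul, mul_one] at h
  have h' : star (bellMatrix.col c) ⬝ᵥ bellMatrix.col c = 2 := h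
  rw [h']
  rfl

theorem gateDc_mulVec_bellMatrix_col (ηx ηy ηz : ℝ) (c : Fin 2 × Fin 2) :
    gateDc ηx ηy ηz *ᵥ bellMatrix.col c =
      Complex.exp (bellPhase ηx ηy ηz c * Complex.I) • bellMatrix.col c := by
  rw [← mulVec_single_one, gateDc_mulVec_bellMatrix_mulVec, ← mulVec_smul]
  congr 1
  ext d
  by_cases h : d = c
  · subst h; simp
  · simp [h]

/-- If a Cartan gate is close, up to the phase `k`, to a local gate on every Bell vector, then its
phases are close to a common multiple of `π / 2`. -/
theorem cos_le_abs_cos_or_cos_le_abs_sin {a b : Matrix (Fin 2) (Fin 2) ℂ}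
    (ha : a ∈ unitaryGroup (Fin 2) ℂ) (hb : b ∈ unitaryGroup (Fin 2) ℂ)
    (hdet : (a.det * b.det) ^ 2 = 1) {k : ℂ} (hk : k = 1 ∨ k = Complex.I)
    (ηx ηy ηz : ℝ) {r : ℝ} (hr : r ≤ Real.pi)
    (hang : ∀ c, angle (WithLp.toLp 2 (k • (gateDc ηx ηy ηz *ᵥ bellMatrix.col c)))
      (WithLp.toLp 2 ((a ⊗ₖ b) *ᵥ bellMatrix.col c)) ≤ r) :
    (∀ c, Real.cos r ≤ |Real.cos (bellPhase ηx ηy ηz c)|) ∨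
      ∀ c, Real.cos r ≤ |Real.sin (bellPhase ηx ηy ηz c)| := by
  have hab : a ⊗ₖ b ∈ unitaryGroup (Fin 2 × Fin 2) ℂ := kronecker_mem_unitary ha hb
  have hknorm : ‖k‖ = 1 := by rcases hk with rfl | rfl <;> simp
  -- the overlap of the local gate with the Bell vector
  set q : Fin 2 × Fin 2 → ℂ := fun c =>
    star k * (star (bellMatrix.col c) ⬝ᵥ ((a ⊗ₖ b) *ᵥ bellMatrix.col c)) with hq
  have hnorm (c : Fin 2 × Fin 2) : ‖WithLp.toLp 2 ((a ⊗ₖ b) *ᵥ bellMatrix.col c)‖ ^ 2 = 2 := by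
    rw [← norm_toLp_bellMatrix_col_sq c, ← real_inner_self_eq_norm_sq,
      ← real_inner_self_eq_norm_sq, real_inner_toLp, real_inner_toLp,
      star_mulVec_dotProduct_mulVec, ← star_eq_conjTranspose, mem_unitaryGroup_iff'.1 hab,
      one_mulVec]
  have hqnorm (c : Fin 2 × Fin 2) : ‖q c‖ ≤ 2 := by
    have h := norm_inner_le_norm (𝕜 := ℂ) (WithLp.toLp 2 (bellMatrix.col c))
      (WithLp.toLp 2 ((a ⊗ₖ b) *ᵥ bellMatrix.col c))
    rw [EuclideanSpace.inner_toLp_toLp, dotProduct_comm] at h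
    rw [hq, norm_mul, norm_star, hknorm, one_mul]
    nlinarith [hnorm c, norm_toLp_bellMatrix_col_sq c]
  have hcos (c : Fin 2 × Fin 2) : 2 * Real.cos r ≤
      Real.cos (bellPhase ηx ηy ηz c) * (q c).re + Real.sin (bellPhase ηx ηy ηz c) * (q c).im := by
    set u := WithLp.toLp 2 (k • (gateDc ηx ηy ηz *ᵥ bellMatrix.col c)) with hu
    set v := WithLp.toLp 2 ((a ⊗ₖ b) *ᵥ bellMatrix.col c) with hv
    have hunorm : ‖u‖ = ‖WithLp.toLp 2 (bellMatrix.col c)‖ := by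
      rw [hu, gateDc_mulVec_bellMatrix_col, WithLp.toLp_smul, WithLp.toLp_smul, norm_smul,
        norm_smul, hknorm, Complex.norm_exp_ofReal_mul_I, one_mul, one_mul]
    have huv : ‖u‖ * ‖v‖ = 2 := by
      have h1 : ‖u‖ ^ 2 = 2 := by rw [hunorm, norm_toLp_bellMatrix_col_sq]
      have h2 : ‖v‖ = ‖u‖ := by
        rw [← sq_eq_sq₀ (norm_nonneg _) (norm_nonneg _), hnorm c, h1]
      rw [h2, ← sq, h1]
    have hinner : inner ℝ u v = Real.cos (bellPhase ηx ηy ηz c) * (q c).re +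
        Real.sin (bellPhase ηx ηy ηz c) * (q c).im := by
      have h : star (k • (gateDc ηx ηy ηz *ᵥ bellMatrix.col c)) ⬝ᵥ
          ((a ⊗ₖ b) *ᵥ bellMatrix.col c) =
          star (Complex.exp (bellPhase ηx ηy ηz c * Complex.I)) * q c := by
        rw [gateDc_mulVec_bellMatrix_col, star_smul, star_smul, smul_dotProduct, smul_dotProduct,
          smul_eq_mul, smul_eq_mul, hq]
        ring
      rw [real_inner_toLp, h]
      simp only [Complex.star_def, Complex.mul_re, Complex.conj_re, Complex.conj_im,
        Complex.exp_ofReal_mul_I_re, Complex.exp_ofReal_mul_I_im]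
      ring
    have hle : Real.cos r ≤ Real.cos (angle u v) :=
      Real.cos_le_cos_of_nonneg_of_le_pi (angle_nonneg _ _) hr (hang c)
    rw [← hinner, ← cos_angle_mul_norm_mul_norm u v, huv]
    linarith
  -- Here `det a * det b = ±1`, so each overlap is `w ± star w`; the factor `star k` swaps real and
  -- imaginary when `k = I`. The choice does not depend on `c`.
  have hreal_or_imag : (∀ c, (q c).im = 0) ∨ ∀ c, (q c).re = 0 := by
    have hw := exists_star_bell_dotProduct_kronecker_mulVec ha hb
    choose w hw using hw
    rcases sq_eq_one_iff.1 hdet with h | h <;> rcases hk with rfl | rfl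
    all_goals simp [hq, hw, h]
  refine hreal_or_imag.imp (fun h c => ?_) fun h c => ?_
  · have h1 := hcos c
    have h2 := (Complex.abs_re_le_norm (q c)).trans (hqnorm c)
    rw [h c, mul_zero, add_zero] at h1
    have h3 := le_abs_self (Real.cos (bellPhase ηx ηy ηz c) * (q c).re)
    rw [abs_mul] at h3
    nlinarith [abs_nonneg (Real.cos (bellPhase ηx ηy ηz c))]
  · have h1 := hcos c
    have h2 := (Complex.abs_im_le_norm (q c)).trans (hqnorm c)
    rw [h c, mul_zero, zero_add] at h1
    have h3 := le_abs_self (Real.sin (bellPhase ηx ηy ηz c) * (q c).im)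
    rw [abs_mul] at h3
    nlinarith [abs_nonneg (Real.sin (bellPhase ηx ηy ηz c))]

/-! ### From phases to the Cartan coordinate -/

/-- Since `3π/4 < π - r`, the point `x` is too far from `±π` and can only be near `0`. -/
theorem abs_le_of_cos_le_abs_cos {r x : ℝ} (hr0 : 0 ≤ r) (hr : r < Real.pi / 4)
    (hx : |x| ≤ 3 * (Real.pi / 4)) (h : Real.cos r ≤ |Real.cos x|) : |x| ≤ r := by
  by_contra! hlt
  have hpi := Real.pi_pos
  have h1 := Real.cos_lt_cos_of_nonneg_of_le_pi hr0 (by linarith) hlt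
  have h2 := Real.cos_lt_cos_of_nonneg_of_le_pi (abs_nonneg x)
    (by linarith : Real.pi - r ≤ Real.pi) (by linarith)
  rw [Real.cos_pi_sub] at h2
  rw [Real.cos_abs] at h1 h2
  exact absurd h (not_le.2 (abs_lt.2 ⟨h2, h1⟩))

theorem abs_sin_lt_cos {r x : ℝ} (hr0 : 0 ≤ r) (hr : r < Real.pi / 4) (hx : |x| ≤ Real.pi / 4) :
    |Real.sin x| < Real.cos r := by
  have hpi := Real.pi_pos
  rw [← Real.sin_pi_div_two_sub, abs_lt, ← Real.sin_neg]
  rw [abs_le] at hx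
  constructor <;> apply Real.sin_lt_sin_of_lt_of_le_pi_div_two <;> linarith

/-- The `L¹` norm of the Cartan coordinate of a gate is at most the sum of those of the Cartan
gates in any circuit for it, as long as this sum is less than `π / 4`. -/
theorem cartan_norm_le_of_circuit (θx θy θz : ℝ) (U : specialUnitaryGroup (Fin 2 × Fin 2) ℂ)
    (ηx ηy ηz : ℝ) (hη : IsCartanCoordinate U.1 ηx ηy ηz) (C : List Instr)
    (hC : circuitOp (gateDc θx θy θz) C = U.1)
    (hlt : circuitCost C * (|θx| + |θy| + |θz|) < Real.pi / 4) :
    |ηx| + |ηy| + |ηz| ≤ circuitCost C * (|θx| + |θy| + |θz|) := by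
  obtain ⟨hzy, hyx, hx, -, k, a, b, c, d, hk, hU⟩ := hη
  obtain ⟨A, hA, B, hB, hdet, hang⟩ := exists_local_gate_angle_le θx θy θz C
  set r := circuitCost C * (|θx| + |θy| + |θz|) with hr
  have hr0 : 0 ≤ r := by positivity
  have hpi := Real.pi_pos
  rw [hC] at hdet hang
  rw [(mem_specialUnitaryGroup_iff.1 U.2).2, eq_comm] at hdet
  have ha := mem_specialUnitaryGroup_iff.1 a.2
  have hb := mem_specialUnitaryGroup_iff.1 b.2
  have hc := mem_specialUnitaryGroup_iff.1 c.2
  have hd := mem_specialUnitaryGroup_iff.1 d.2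
  have hcd : (c.1 ⊗ₖ d.1) * (star c.1 ⊗ₖ star d.1) = 1 := by
    rw [← mul_kronecker_mul, mem_unitaryGroup_iff.1 hc.1, mem_unitaryGroup_iff.1 hd.1,
      one_kronecker_one]
  have hab : (star a.1 ⊗ₖ star b.1) * (a.1 ⊗ₖ b.1) = 1 := by
    rw [← mul_kronecker_mul, mem_unitaryGroup_iff'.1 ha.1, mem_unitaryGroup_iff'.1 hb.1,
      one_kronecker_one]
  have hdetstar {M : Matrix (Fin 2) (Fin 2) ℂ} (h : M.det = 1) : (star M).det = 1 := by
    rw [star_eq_conjTranspose, det_conjTranspose, h, star_one]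
  have key := cos_le_abs_cos_or_cos_le_abs_sin (a := star a.1 * A * star c.1)
    (b := star b.1 * B * star d.1) (k := k) (r := r)
    (mul_mem (mul_mem (Unitary.star_mem ha.1) hA) (Unitary.star_mem hc.1))
    (mul_mem (mul_mem (Unitary.star_mem hb.1) hB) (Unitary.star_mem hd.1))
    (by
      rw [det_mul, det_mul, det_mul, det_mul, hdetstar ha.2, hdetstar hb.2, hdetstar hc.2,
        hdetstar hd.2, one_mul, one_mul, mul_one, mul_one, hdet])
    hk ηx ηy ηz (by linarith)
    (by
      intro e
      -- Chosen so that the right local factor of `U` sends it to a Bell vector.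
      set v := (star c.1 ⊗ₖ star d.1) *ᵥ bellMatrix.col e with hv
      have hv' : (c.1 ⊗ₖ d.1) *ᵥ v = bellMatrix.col e := by
        rw [hv, mulVec_mulVec, hcd, one_mulVec]
      have hv0 : v ≠ 0 := by
        intro h0
        have h := norm_toLp_bellMatrix_col_sq e
        rw [← hv', h0, mulVec_zero] at h
        simp at h
      have hunit := kronecker_mem_unitary (Unitary.star_mem ha.1) (Unitary.star_mem hb.1)
      have h := hang v hv0
      rw [← angle_unitary_mulVec hunit, hU, smul_mulVec, mulVec_smul, mulVec_mulVec,
        ← Matrix.mul_assoc, ← Matrix.mul_assoc, hab, one_mul, ← mulVec_mulVec, hv',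
        mulVec_mulVec, ← mul_kronecker_mul, hv, mulVec_mulVec, ← mul_kronecker_mul] at h
      exact h)
  have hz := abs_le.1 hzy
  have hy0 : 0 ≤ ηy := (abs_nonneg _).trans hzy
  have hx0 : 0 ≤ ηx := hy0.trans hyx
  rcases key with key | key
  · rw [abs_of_nonneg hx0, abs_of_nonneg hy0]
    -- The phase of modulus `k_t(U)` is `-(ηx + ηy + ηz)` at `(1, 1)` or `ηx + ηy - ηz` at `(1, 0)`,
    -- by the sign of `ηz`.
    rcases abs_cases ηz with ⟨hzabs, _⟩ | ⟨hzabs, _⟩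
    · have h := abs_le_of_cos_le_abs_cos hr0 hlt
        ((abs_bellPhase_le ηx ηy ηz (1, 1)).trans ?_) (key (1, 1))
      · have := neg_le_of_abs_le h
        simp [bellPhase] at this
        linarith
      · rw [abs_of_nonneg hx0, abs_of_nonneg hy0]
        linarith
    · have h := abs_le_of_cos_le_abs_cos hr0 hlt
        ((abs_bellPhase_le ηx ηy ηz (1, 0)).trans ?_) (key (1, 0))
      · have := le_of_abs_le h
        simp [bellPhase] at this
        linarith
      · rw [abs_of_nonneg hx0, abs_of_nonneg hy0]
        linarith
  -- The phase `ηx - ηy + ηz` always lies in `[-π/4, π/4]`.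
  · refine absurd (key (0, 0)) (not_le.2 (abs_sin_lt_cos hr0 hlt ?_))
    simp only [bellPhase]
    rw [abs_le]
    constructor <;> simp <;> linarith

theorem corollary2 (θx θy θz : ℝ) (hθx : 0 ≤ θx) (hθy : 0 ≤ θy)
    (U : Matrix.specialUnitaryGroup (Fin 2 × Fin 2) ℂ)
    (ηx ηy ηz : ℝ) (hη : IsCartanCoordinate U.1 ηx ηy ηz) (N : ℕ) :
    (IsDecompositionCost (gateDb θx θy) U.1 N →
      N * (θx + θy) < Real.pi / 4 →
        Real.sin (|ηx| + |ηy| + |ηz|) ≤ Real.sin (N * (θx + θy))) ∧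
    (IsDecompositionCost (gateDc θx θy θz) U.1 N →
      N * (θx + θy + |θz|) < Real.pi / 4 →
        Real.sin (|ηx| + |ηy| + |ηz|) ≤ Real.sin (N * (θx + θy + |θz|))) := by
  have main (t : ℝ) (hcost : IsDecompositionCost (gateDc θx θy t) U.1 N)
      (hlt : N * (θx + θy + |t|) < Real.pi / 4) :
      Real.sin (|ηx| + |ηy| + |ηz|) ≤ Real.sin (N * (θx + θy + |t|)) := by
    obtain ⟨C, hC, rfl⟩ := hcost.1
    have h := cartan_norm_le_of_circuit θx θy t U ηx ηy ηz hη C hC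
    rw [abs_of_nonneg hθx, abs_of_nonneg hθy] at h
    have hpi := Real.pi_pos
    have h0 : 0 ≤ |ηx| + |ηy| + |ηz| := by positivity
    exact Real.sin_le_sin_of_le_of_le_pi_div_two (by linarith) (by linarith) (h hlt)
  refine ⟨fun hcost hlt => ?_, main θz⟩
  rw [gateDb_eq_gateDc] at hcost
  simpa using main 0 hcost (by simpa using hlt)
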